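/- Let $V$ be a finite set and let $A\le \mathrm{Sym}(V)$ be a cyclic permutation group of prime power order $p^n$, with $p$ prime and $n\ge 1$. For a natural number $k$, say that $A\in GR(k)$ if there is a coloring $E$ of the two-element subsets of $V$ with at most $k$ colors whose full automorphism group $\{\sigma\in \mathrm{Sym}(V) : E(\{\sigma(v),\sigma(w)\})=E(\{v,w\}) \text{ for all distinct } v,w\in V\}$ is equal to $A$, and say that $A \in GR$ if $A\in GR(k)$ for some $k$. Then $A\in GR$ if and only if $A$ has at least two orbits on $V$ of cardinality greater than two, or $A$ has order two. Moreover, if $A\in GR$, then $A\in GR(3)$. -/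

import Mathlib

/-- The automorphism group of an edge-colored complete graph on `V`: all permutations `σ` of `V`
such that every edge `{v, w}` has the same color as its image `{σ v, σ w}`. -/
def edgeColorAut {V K : Type*} (E : SimpleGraph.TopEdgeLabeling V K) :
    Subgroup (Equiv.Perm V) where
  carrier := {σ | ∀ (v w : V) (h : v ≠ w),
    E.get (σ v) (σ w) (σ.injective.ne h) = E.get v w h}
  mul_mem' := by
    intro σ τ hσ hτ v w h
    exact (hσ (τ v) (τ w) (τ.injective.ne h)).trans (hτ v w h)
  one_mem' := by
    intro v w h
    rfl
  inv_mem' := by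
    intro σ hσ v w h
    have key := hσ (σ⁻¹ v) (σ⁻¹ w) ((σ⁻¹).injective.ne h)
    simp only [← Equiv.Perm.mul_apply, mul_inv_cancel, Equiv.Perm.one_apply] at key
    exact key.symm

/-- `GR(k)`: the permutation group `A` on `V` is the full automorphism group of some complete
graph on `V` whose edges are colored with at most `k` colors. -/
def InGRk {V : Type*} (k : ℕ) (A : Subgroup (Equiv.Perm V)) : Prop :=
  ∃ E : SimpleGraph.TopEdgeLabeling V (Fin k), edgeColorAut E = A

/-- `GR`: the union of all the classes `GR(k)`. -/
def InGR {V : Type*} (A : Subgroup (Equiv.Perm V)) : Prop :=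
  ∃ k : ℕ, InGRk k A

/-- `A` has at least two distinct orbits of cardinality greater than two. -/
def TwoLargeOrbits {V : Type*} (A : Subgroup (Equiv.Perm V)) : Prop :=
  ∃ ω₁ ω₂ : MulAction.orbitRel.Quotient A V,
    ω₁ ≠ ω₂ ∧ 2 < ω₁.orbit.ncard ∧ 2 < ω₂.orbit.ncard

open Equiv

/-! Prime power order yields a point `v₀` with trivial stabilizer; let R be its orbit, on which `A`
acts regularly.

Necessity: if all orbits other than R have at most two points, every square in `A` fixes every point
outside R. Then the reflection `a v₀ ↦ a⁻¹ v₀` of R, extended by the identity, preserves every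
`A`-invariant colouring. Were it in `A`, it would be trivial, since it fixes `v₀`, so the generator
would square to 1.

Sufficiency: R projects equivariantly onto every orbit. Colour 2 joins a moved point outside R to
its fibre, and also most pairs inside R, so that R is recognised by its colour-2 degrees
(`ncard_neighbors_lt`). Between R and its complement, colour 1 occurs only at the orbit of rank 1,
chosen large unless `A` has order 2; there it marks the fibre shifted by the generator, which
orients the structure. Colours 0 and 1 outside R encode a parity that separates the other orbits
(`rank_automorphism`). The two marked fibres make an automorphism commute with the generator on R up
to the stabilizer of a point of rank 1; the cycle of the generator, drawn in R with colour 0,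
removes that ambiguity (`automorphism_gen`). -/

/-- A generator of the permutation group `A`, a point with trivial stabilizer, and an
enumeration of the orbits by an initial segment of `ℕ` that starts with the orbit of this point. -/
structure OrbitFrame {V : Type*} (A : Subgroup (Perm V)) where
  gen : Perm V
  zpowers_gen : Subgroup.zpowers gen = A
  origin : V
  free : ∀ a ∈ A, a origin = origin → a = 1
  rank : V → ℕ
  rank_eq_iff : ∀ u v, rank u = rank v ↔ ∃ a ∈ A, a u = v
  rank_origin : rank origin = 0
  rank_initial : ∀ v, ∀ j ≤ rank v, ∃ u, rank u = j

/-! ### Cyclic action on the orbits and projections of the regular orbit -/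

namespace OrbitFrame

variable {V : Type*} {A : Subgroup (Perm V)} (F : OrbitFrame A)

theorem apply_comm (F : OrbitFrame A) {a b : Perm V} (ha : a ∈ A) (hb : b ∈ A) (v : V) : a (b v) = b (a v) := by
  rw [← F.zpowers_gen] at ha hb
  obtain ⟨i, rfl⟩ := ha
  obtain ⟨j, rfl⟩ := hb
  change (F.gen ^ i * F.gen ^ j) v = (F.gen ^ j * F.gen ^ i) v
  rw [← zpow_add, ← zpow_add, add_comm]

theorem gen_mem : F.gen ∈ A := by
  have h := Subgroup.mem_zpowers F.gen
  rwa [F.zpowers_gen] at h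

theorem rank_apply {a : Perm V} (ha : a ∈ A) (v : V) : F.rank (a v) = F.rank v :=
  ((F.rank_eq_iff v (a v)).2 ⟨a, ha, rfl⟩).symm

/-- The base point of the orbit of `v`. -/
noncomputable def base (v : V) : V :=
  haveI : Nonempty V := ⟨v⟩
  Function.invFun F.rank (F.rank v)

theorem rank_base (v : V) : F.rank (F.base v) = F.rank v :=
  haveI : Nonempty V := ⟨v⟩
  Function.invFun_eq (f := F.rank) ⟨v, rfl⟩

theorem base_eq {u v : V} (h : F.rank u = F.rank v) : F.base u = F.base v := by
  simp only [base, h]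

/-- `y` corresponds to the point `x` of the regular orbit under the equivariant projection of
the regular orbit onto the orbit of `y` that sends the origin to the base point. -/
def Linked (x y : V) : Prop :=
  ∃ a ∈ A, a F.origin = x ∧ a (F.base y) = y

variable {F}

theorem Linked.rank_eq_zero {x y : V} (h : F.Linked x y) : F.rank x = 0 := by
  obtain ⟨a, ha, rfl, -⟩ := h
  rw [F.rank_apply ha, F.rank_origin]

theorem Linked.apply {x y : V} (h : F.Linked x y) {c : Perm V} (hc : c ∈ A) :
    F.Linked (c x) (c y) := by
  obtain ⟨a, ha, rfl, h2⟩ := h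
  refine ⟨c * a, A.mul_mem hc ha, rfl, ?_⟩
  rw [F.base_eq (F.rank_apply hc y), Perm.mul_apply, h2]

theorem linked_apply_iff {c : Perm V} (hc : c ∈ A) {x y : V} :
    F.Linked (c x) (c y) ↔ F.Linked x y := by
  refine ⟨fun h => ?_, fun h => h.apply hc⟩
  simpa using h.apply (A.inv_mem hc)

theorem Linked.eq_right {x y z : V} (hy : F.Linked x y) (hz : F.Linked x z)
    (h : F.rank y = F.rank z) : y = z := by
  obtain ⟨a, ha, rfl, h2⟩ := hy
  obtain ⟨b, hb, h3, h4⟩ := hz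
  have : a⁻¹ * b = 1 := F.free _ (A.mul_mem (A.inv_mem ha) hb) (by simp [h3])
  rw [inv_mul_eq_one] at this
  rw [← h2, ← h4, this, F.base_eq h]

/-- The fibre over `y` is a single orbit of the stabilizer of `y`. -/
theorem Linked.exists_left {x x' y : V} (h : F.Linked x y) (h' : F.Linked x' y) :
    ∃ c ∈ A, c x = x' ∧ c y = y := by
  obtain ⟨a, ha, rfl, h2⟩ := h
  obtain ⟨b, hb, rfl, h4⟩ := h'
  refine ⟨b * a⁻¹, A.mul_mem hb (A.inv_mem ha), by simp, ?_⟩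
  nth_rewrite 1 [← h2]
  simpa using h4

variable (F)

theorem exists_linked_right {x : V} (hx : F.rank x = 0) (y : V) :
    ∃ z, F.rank z = F.rank y ∧ F.Linked x z := by
  obtain ⟨a, ha, rfl⟩ := (F.rank_eq_iff F.origin x).1 (F.rank_origin.trans hx.symm)
  have h : F.rank (a (F.base y)) = F.rank y := (F.rank_apply ha _).trans (F.rank_base y)
  exact ⟨a (F.base y), h, a, ha, rfl, by rw [F.base_eq h]⟩

theorem exists_linked_left (y : V) : ∃ x, F.Linked x y := by
  obtain ⟨a, ha, h⟩ := (F.rank_eq_iff (F.base y) y).1 (F.rank_base y)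
  exact ⟨a F.origin, a, ha, rfl, h⟩

theorem eq_one_of_apply {a : Perm V} (ha : a ∈ A) {x : V} (hx : F.rank x = 0) (h : a x = x) :
    a = 1 := by
  obtain ⟨b, hb, rfl⟩ := (F.rank_eq_iff F.origin x).1 (F.rank_origin.trans hx.symm)
  refine F.free a ha (b.injective ?_)
  rw [← F.apply_comm ha hb, h]

theorem apply_eq_self_of_rank_eq {a : Perm V} (ha : a ∈ A) {u v : V} (huv : F.rank u = F.rank v)
    (h : a u = u) : a v = v := by
  obtain ⟨b, hb, rfl⟩ := (F.rank_eq_iff u v).1 huv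
  rw [F.apply_comm ha hb, h]

theorem ncard_rank_zero : {x | F.rank x = 0}.ncard = Nat.card A := by
  rw [← Nat.card_coe_set_eq]
  refine (Nat.card_congr (Equiv.ofBijective
    (fun a : A => (⟨a.1 F.origin, (F.rank_apply a.2 _).trans F.rank_origin⟩ :
      {x | F.rank x = 0})) ⟨fun a b h => ?_, fun x => ?_⟩)).symm
  · have h' : a.1 F.origin = b.1 F.origin := congrArg Subtype.val h
    have := F.free (a.1⁻¹ * b.1) (A.mul_mem (A.inv_mem a.2) b.2) (by simp [← h'])
    exact Subtype.ext (inv_mul_eq_one.1 this)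
  · obtain ⟨b, hb, h⟩ := (F.rank_eq_iff F.origin x).1 (F.rank_origin.trans x.2.symm)
    exact ⟨⟨b, hb⟩, Subtype.ext h⟩

theorem gen_ne_one (hN : 2 ≤ Nat.card A) : F.gen ≠ 1 := by
  intro h
  have : A = ⊥ := by rw [← F.zpowers_gen, h, Subgroup.zpowers_one_eq_bot]
  rw [this, Subgroup.card_bot] at hN
  omega

theorem apply_eq_self_of_gen {v : V} (h : F.gen v = v) {a : Perm V} (ha : a ∈ A) : a v = v := by
  rw [← F.zpowers_gen] at ha
  obtain ⟨i, rfl⟩ := ha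
  exact Perm.zpow_apply_eq_self_of_apply_eq_self h i

/-! ### The colouring -/

open Classical in
/-- The colour of a pair of points in the regular orbit. -/
noncomputable def innerColor (u v : V) : Fin 3 :=
  if 5 ≤ Nat.card A ∧ (v = F.gen u ∨ u = F.gen v) then 0 else 2

open Classical in
/-- The colour of the pair of a point `x` in the regular orbit and a point `y` outside. -/
noncomputable def crossColor (x y : V) : Fin 3 :=
  if F.Linked x y ∧ F.gen y ≠ y then 2
  else if F.rank y = 1 ∧ F.Linked x (F.gen y) then 1 else 0

/-- The colour of a pair of points outside the regular orbit. -/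
def outerColor (u v : V) : Fin 3 :=
  if max (F.rank u) (F.rank v) % 2 = 0 then 0 else 1

/-- A colouring whose automorphism group is `A`. -/
noncomputable def color (u v : V) : Fin 3 :=
  if F.rank u = 0 then
    if F.rank v = 0 then F.innerColor u v else F.crossColor u v
  else if F.rank v = 0 then F.crossColor v u else F.outerColor u v

theorem color_comm (u v : V) : F.color v u = F.color u v := by
  unfold color
  split_ifs
  · classical exact if_congr (and_congr_right' or_comm) rfl rfl
  · rfl
  · rfl
  · unfold outerColor
    rw [max_comm]

/-- The edge labeling given by `OrbitFrame.color`. -/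
noncomputable def labeling : SimpleGraph.TopEdgeLabeling V (Fin 3) :=
  SimpleGraph.EdgeLabeling.mk (fun u v _ => F.color u v) (fun u v _ => F.color_comm u v)

theorem mem_edgeColorAut_labeling {φ : Perm V} :
    φ ∈ edgeColorAut F.labeling ↔ ∀ u v, u ≠ v → F.color (φ u) (φ v) = F.color u v :=
  Iff.rfl

variable {F}

theorem color_of_rank_zero {u v : V} (hu : F.rank u = 0) (hv : F.rank v = 0) :
    F.color u v = F.innerColor u v := by
  simp [color, hu, hv]

theorem color_of_rank_zero_left {u v : V} (hu : F.rank u = 0) (hv : F.rank v ≠ 0) :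
    F.color u v = F.crossColor u v := by
  simp [color, hu, hv]

theorem color_of_rank_ne_zero {u v : V} (hu : F.rank u ≠ 0) (hv : F.rank v ≠ 0) :
    F.color u v = F.outerColor u v := by
  simp [color, hu, hv]

theorem crossColor_eq_two_iff {x y : V} :
    F.crossColor x y = 2 ↔ F.Linked x y ∧ F.gen y ≠ y := by
  unfold crossColor
  split_ifs with h1 h2 <;> simp [h1]

theorem not_linked_of_linked_gen {x y : V} (h : F.Linked x (F.gen y)) (hy : F.gen y ≠ y) :
    ¬ F.Linked x y := fun h' =>
  hy (h.eq_right h' (F.rank_apply F.gen_mem y))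

theorem crossColor_eq_one_iff {x y : V} :
    F.crossColor x y = 1 ↔ F.rank y = 1 ∧ F.Linked x (F.gen y) := by
  unfold crossColor
  split_ifs with h1 h2
  · simp only [Fin.reduceEq, false_iff, not_and]
    exact fun _ h => not_linked_of_linked_gen h h1.2 h1.1
  · simp [h2]
  · simp [h2]

variable (F)

theorem innerColor_apply {a : Perm V} (ha : a ∈ A) (u v : V) :
    F.innerColor (a u) (a v) = F.innerColor u v := by
  classical
  have h : ∀ w, F.gen (a w) = a (F.gen w) := F.apply_comm F.gen_mem ha
  refine if_congr ?_ rfl rfl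
  simp only [h, a.injective.eq_iff]

theorem crossColor_apply {a : Perm V} (ha : a ∈ A) (u v : V) :
    F.crossColor (a u) (a v) = F.crossColor u v := by
  classical
  have h : ∀ w, F.gen (a w) = a (F.gen w) := F.apply_comm F.gen_mem ha
  refine if_congr ?_ rfl (if_congr ?_ rfl rfl) <;>
  simp only [h, a.injective.eq_iff, linked_apply_iff ha, F.rank_apply ha, ne_eq]

theorem le_edgeColorAut : A ≤ edgeColorAut F.labeling := by
  intro a ha
  rw [mem_edgeColorAut_labeling]
  intro u v _
  unfold color outerColor
  simp only [F.rank_apply ha, F.innerColor_apply ha, F.crossColor_apply ha]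

/-! ### The regular orbit is preserved -/

/-- The points joined to `v` by an edge of colour `2`. -/
def neighbors (v : V) : Set V := {u | v ≠ u ∧ F.color v u = 2}

theorem ncard_neighbors_apply {φ : Perm V} (hφ : φ ∈ edgeColorAut F.labeling) (v : V) :
    (F.neighbors (φ v)).ncard = (F.neighbors v).ncard := by
  rw [← Set.ncard_image_of_injective (F.neighbors v) φ.injective]
  congr 1
  ext u
  obtain ⟨u, rfl⟩ := φ.surjective u
  simp only [neighbors, Set.mem_ofPred_eq, φ.injective.mem_set_image, φ.injective.ne_iff]
  exact and_congr_right fun h => by rw [F.mem_edgeColorAut_labeling.1 hφ _ _ h]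

theorem neighbors_subset {y : V} (hy : F.rank y ≠ 0) :
    F.neighbors y ⊆ {x | F.Linked x y ∧ F.gen y ≠ y} := by
  rintro x ⟨-, hx⟩
  by_cases h : F.rank x = 0
  · rw [F.color_comm, color_of_rank_zero_left h hy] at hx
    exact crossColor_eq_two_iff.1 hx
  · rw [color_of_rank_ne_zero hy h, outerColor] at hx
    split_ifs at hx <;> simp at hx

/-- The fibre over a moved point and its shift by the generator are disjoint subsets of the regular
orbit. -/
theorem two_mul_ncard_neighbors_le [Finite V] {y : V} (hy : F.rank y ≠ 0) :
    2 * (F.neighbors y).ncard ≤ Nat.card A := by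
  set S := {x | F.Linked x y ∧ F.gen y ≠ y} with hS
  have h1 : (F.neighbors y).ncard ≤ S.ncard := Set.ncard_le_ncard (F.neighbors_subset hy)
  have h2 : Disjoint S (F.gen '' S) := by
    rw [Set.disjoint_left]
    rintro x hx ⟨z, hz, rfl⟩
    exact not_linked_of_linked_gen (hz.1.apply F.gen_mem) hx.2 hx.1
  have h3 : S ∪ F.gen '' S ⊆ {x | F.rank x = 0} := by
    rintro x (hx | ⟨z, hz, rfl⟩)
    · exact hx.1.rank_eq_zero
    · exact (F.rank_apply F.gen_mem z).trans hz.1.rank_eq_zero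
  have h4 := Set.ncard_le_ncard h3
  rw [F.ncard_rank_zero, Set.ncard_union_eq h2,
    Set.ncard_image_of_injective _ F.gen.injective] at h4
  omega

theorem exists_ncard_neighbors_ge [Finite V] {x : V} (hx : F.rank x = 0) :
    ∃ s ⊆ F.neighbors x, s ⊆ {u | F.rank u = 0} ∧
      Nat.card A ≤ s.ncard + (if 5 ≤ Nat.card A then 3 else 1) := by
  have key : ∀ t : Set V, (∀ u, F.rank u = 0 → u ∉ t → x ≠ u ∧ F.innerColor x u = 2) →
      ∀ n, t.ncard ≤ n → ∃ s ⊆ F.neighbors x, s ⊆ {u | F.rank u = 0} ∧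
      Nat.card A ≤ s.ncard + n := by
    intro t ht n hn
    refine ⟨{u | F.rank u = 0} \ t, ?_, Set.sdiff_subset, ?_⟩
    · rintro u ⟨hu, hut⟩
      exact ⟨(ht u hu hut).1, (color_of_rank_zero hx hu).trans (ht u hu hut).2⟩
    · have := Set.le_ncard_sdiff t {u | F.rank u = 0}
      rw [F.ncard_rank_zero] at this
      omega
  split_ifs with h5
  · refine key {x, F.gen x, F.gen⁻¹ x} (fun u _ hu => ?_) 3 (Set.ncard_insert_le _ _ |>.trans ?_)
    · simp only [Set.mem_insert_iff, Set.mem_singleton_iff, not_or, Perm.eq_inv_iff_eq] at hu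
      refine ⟨Ne.symm hu.1, ?_⟩
      unfold innerColor
      rw [if_neg]
      rintro ⟨-, h | h⟩
      · exact hu.2.1 h
      · exact hu.2.2 h.symm
    · exact Nat.succ_le_succ ((Set.ncard_insert_le _ _).trans (by simp))
  · refine key {x} (fun u _ hu => ⟨Ne.symm hu, ?_⟩) 1 (by simp)
    simp [innerColor, h5]

/-- For moved `y`, the extra neighbour of `x` in the orbit of `y` gives at least `|A| - 2` against
at most `|A| / 2` when `|A| ≥ 5`. Below 5 no cycle is drawn, which avoids a tie at order 4. -/
theorem ncard_neighbors_lt [Finite V] (hN : 2 ≤ Nat.card A) {x y : V} (hx : F.rank x = 0)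
    (hy : F.rank y ≠ 0) : (F.neighbors y).ncard < (F.neighbors x).ncard := by
  obtain ⟨s, hs, hs0, hsN⟩ := F.exists_ncard_neighbors_ge hx
  by_cases hmove : F.gen y = y
  · have h0 : F.neighbors y = ∅ :=
      Set.subset_empty_iff.1 fun u hu => (F.neighbors_subset hy hu).2 hmove
    have := Set.ncard_le_ncard hs
    rw [h0, Set.ncard_empty]
    split_ifs at hsN <;> omega
  · obtain ⟨z, hz, hxz⟩ := F.exists_linked_right hx y
    have hz0 : F.rank z ≠ 0 := hz ▸ hy
    have hzx : z ∈ F.neighbors x := by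
      refine ⟨fun h => hz0 (h ▸ hx), ?_⟩
      rw [color_of_rank_zero_left hx hz0, crossColor_eq_two_iff]
      exact ⟨hxz, fun h => hmove (F.apply_eq_self_of_rank_eq F.gen_mem hz h)⟩
    have h1 := Set.ncard_le_ncard (Set.insert_subset hzx hs)
    rw [Set.ncard_insert_of_notMem fun h => hz0 (hs0 h)] at h1
    have h2 := F.two_mul_ncard_neighbors_le hy
    split_ifs at hsN <;> omega

theorem rank_apply_eq_zero_iff [Finite V] (hN : 2 ≤ Nat.card A) {φ : Perm V}
    (hφ : φ ∈ edgeColorAut F.labeling) (v : V) : F.rank (φ v) = 0 ↔ F.rank v = 0 := by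
  have h := F.ncard_neighbors_apply hφ v
  constructor <;> intro h0 <;> by_contra h1
  · exact absurd h (F.ncard_neighbors_lt hN h0 h1).ne'
  · exact absurd h (F.ncard_neighbors_lt hN h0 h1).ne

/-! ### All orbits are preserved -/

/-- Points of rank 1 are the only ones outside the regular orbit that meet it in colour 1. -/
theorem rank_apply_eq_one_iff [Finite V] (hN : 2 ≤ Nat.card A) {φ : Perm V}
    (hφ : φ ∈ edgeColorAut F.labeling) (v : V) : F.rank (φ v) = 1 ↔ F.rank v = 1 := by
  have key : ∀ {ψ : Perm V}, ψ ∈ edgeColorAut F.labeling → ∀ w, F.rank w = 1 →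
      F.rank (ψ w) = 1 := by
    intro ψ hψ w hw
    have hw0 : F.rank w ≠ 0 := by omega
    obtain ⟨x, hx⟩ := F.exists_linked_left w
    have hx0 : F.rank (F.gen x) = 0 := (F.rank_apply F.gen_mem x).trans hx.rank_eq_zero
    have h1 : F.color (F.gen x) w = 1 := by
      rw [color_of_rank_zero_left hx0 hw0, crossColor_eq_one_iff]
      exact ⟨hw, hx.apply F.gen_mem⟩
    rw [← F.mem_edgeColorAut_labeling.1 hψ _ _ (fun h => hw0 (by rw [← h, hx0])),
      color_of_rank_zero_left ((F.rank_apply_eq_zero_iff hN hψ _).2 hx0)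
        (mt (F.rank_apply_eq_zero_iff hN hψ _).1 hw0)] at h1
    exact (crossColor_eq_one_iff.1 h1).1
  refine ⟨fun h => ?_, key hφ v⟩
  simpa using key (inv_mem hφ) (φ v) h

theorem rank_automorphism [Finite V] (hN : 2 ≤ Nat.card A) {φ : Perm V}
    (hφ : φ ∈ edgeColorAut F.labeling) (v : V) : F.rank (φ v) = F.rank v := by
  obtain ⟨m, hm⟩ : ∃ m, ∀ u, F.rank u < m := by
    obtain ⟨m, hm⟩ := (Set.finite_range F.rank).bddAbove
    exact ⟨m + 1, fun u => Nat.lt_succ_of_le (hm ⟨u, rfl⟩)⟩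
  -- Downward induction on the rank `j`: the orbits of larger rank are already known to be
  -- preserved.
  suffices h : ∀ d j, m ≤ j + d → ∀ ψ ∈ edgeColorAut F.labeling, ∀ u, j ≤ F.rank u →
      F.rank (ψ u) = F.rank u from h m 0 (by omega) φ hφ v (Nat.zero_le _)
  intro d
  induction d with
  | zero => intro j hj ψ _ u hu; have := hm u; omega
  | succ d ih =>
    intro j hj ψ hψ u hu
    rcases hu.lt_or_eq with hlt | rfl
    · exact ih (j + 1) (by omega) ψ hψ u hlt
    have hψ' : ψ⁻¹ ∈ edgeColorAut F.labeling := inv_mem hψ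
    have up : ∀ χ ∈ edgeColorAut F.labeling, ∀ w, F.rank u < F.rank w →
        F.rank (χ w) = F.rank w := fun χ hχ w hw => ih _ (by omega) χ hχ w hw
    have hle : ∀ χ ∈ edgeColorAut F.labeling, ∀ w, F.rank w ≤ F.rank u →
        F.rank (χ w) ≤ F.rank u := by
      intro χ hχ w hw
      by_contra! h
      have := up χ⁻¹ (inv_mem hχ) (χ w) h
      rw [Perm.inv_def, Equiv.symm_apply_apply] at this
      omega
    by_contra hne
    have hlt : F.rank (ψ u) < F.rank u := lt_of_le_of_ne (hle ψ hψ u le_rfl) hne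
    have hz := F.rank_apply_eq_zero_iff hN hψ u
    have ho := F.rank_apply_eq_one_iff hN hψ u
    -- If `ψ` lowered the rank of `u`, a partner `w` making the maximum exactly one less than `rank
    -- u` would flip the parity. When `ψ u` itself has rank `rank u - 1`, a point of rank 1 serves;
    -- it differs from `ψ u` because rank 1 is preserved.
    obtain ⟨w, hw0, hne', hmax⟩ : ∃ w, F.rank w ≠ 0 ∧ ψ u ≠ w ∧
        max (F.rank (ψ u)) (F.rank w) + 1 = F.rank u := by
      by_cases hi : F.rank (ψ u) + 1 = F.rank u
      · obtain ⟨w, hw⟩ := F.rank_initial u 1 (by omega)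
        exact ⟨w, by omega, fun h => by subst h; omega, by omega⟩
      · obtain ⟨w, hw⟩ := F.rank_initial u (F.rank u - 1) (by omega)
        exact ⟨w, by omega, fun h => by subst h; omega, by omega⟩
    obtain ⟨z, rfl⟩ := ψ.surjective w
    have hz0 := mt (F.rank_apply_eq_zero_iff hN hψ z).2 hw0
    have hzu := hle ψ⁻¹ hψ' (ψ z) (by omega)
    rw [Perm.inv_def, Equiv.symm_apply_apply] at hzu
    have hcol := F.mem_edgeColorAut_labeling.1 hψ u z fun h => hne' (h ▸ rfl)
    rw [color_of_rank_ne_zero (by omega) hw0, color_of_rank_ne_zero (by omega) hz0, outerColor,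
      outerColor, max_eq_left hzu] at hcol
    split_ifs at hcol <;> omega

end OrbitFrame

namespace OrbitFrame

variable {V : Type*} {A : Subgroup (Perm V)} (F : OrbitFrame A)

/-! ### The automorphisms commute with the generator on the regular orbit -/

theorem linked_automorphism [Finite V] (hN : 2 ≤ Nat.card A) {φ : Perm V}
    (hφ : φ ∈ edgeColorAut F.labeling) {x y : V} (hy0 : F.rank y ≠ 0) (hy : F.gen y ≠ y)
    (h : F.Linked x y) : F.Linked (φ x) (φ y) := by
  have hx0 := h.rank_eq_zero
  have hc : F.color x y = 2 := by
    rw [color_of_rank_zero_left hx0 hy0, crossColor_eq_two_iff]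
    exact ⟨h, hy⟩
  rw [← F.mem_edgeColorAut_labeling.1 hφ x y (fun h => hy0 (h ▸ hx0)),
    color_of_rank_zero_left (by rwa [F.rank_automorphism hN hφ])
      (by rwa [F.rank_automorphism hN hφ]), crossColor_eq_two_iff] at hc
  exact hc.1

theorem linked_gen_automorphism [Finite V] (hN : 2 ≤ Nat.card A) {φ : Perm V}
    (hφ : φ ∈ edgeColorAut F.labeling) {x y : V} (hy : F.rank y = 1)
    (h : F.Linked x (F.gen y)) : F.Linked (φ x) (F.gen (φ y)) := by
  have hx0 := h.rank_eq_zero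
  have hy0 : F.rank y ≠ 0 := by omega
  have hc : F.color x y = 1 := by
    rw [color_of_rank_zero_left hx0 hy0, crossColor_eq_one_iff]
    exact ⟨hy, h⟩
  rw [← F.mem_edgeColorAut_labeling.1 hφ x y (fun h => hy0 (h ▸ hx0)),
    color_of_rank_zero_left (by rwa [F.rank_automorphism hN hφ])
      (by rwa [F.rank_automorphism hN hφ]), crossColor_eq_one_iff] at hc
  exact hc.2

/-- Orbit-stabilizer: an orbit of at least 3 points times a stabilizer of order at least 2 gives
order at least 6. So the cycle is drawn whenever it is needed. -/
theorem five_le_card [Finite V] {y : V} (hy : F.gen (F.gen y) ≠ y) {c : Perm V} (hc : c ∈ A)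
    (hcy : c y = y) (hc1 : c ≠ 1) : 5 ≤ Nat.card A := by
  have h1 := Nat.card_congr (MulAction.orbitProdStabilizerEquivGroup A y)
  rw [Nat.card_prod] at h1
  have h2 : 1 < Nat.card (MulAction.stabilizer A y) := by
    rw [Subgroup.one_lt_card_iff_ne_bot, Subgroup.ne_bot_iff_exists_ne_one]
    exact ⟨⟨⟨c, hc⟩, hcy⟩, fun h => hc1 (congrArg (fun t => t.1.1) h)⟩
  have hy1 : F.gen y ≠ y := fun h => hy (by rw [h, h])
  have h3 : ({y, F.gen y, F.gen (F.gen y)} : Set V) ⊆ MulAction.orbit A y := by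
    rintro z (rfl | rfl | rfl)
    · exact MulAction.mem_orbit_self _
    · exact ⟨⟨F.gen, F.gen_mem⟩, rfl⟩
    · exact ⟨⟨F.gen * F.gen, A.mul_mem F.gen_mem F.gen_mem⟩, rfl⟩
  have h4 := Set.ncard_le_ncard h3
  rw [Set.ncard_eq_three.2 ⟨_, _, _, hy1.symm, hy.symm, (F.gen.injective.ne hy1).symm, rfl⟩,
    ← Nat.card_coe_set_eq] at h4
  nlinarith

theorem automorphism_gen [Finite V]
    (hF : Nat.card A = 2 ∨ 2 ≤ Nat.card A ∧ ∃ v, F.rank v = 1 ∧ F.gen (F.gen v) ≠ v)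
    {φ : Perm V} (hφ : φ ∈ edgeColorAut F.labeling) {x : V} (hx : F.rank x = 0) :
    φ (F.gen x) = F.gen (φ x) := by
  have hN : 2 ≤ Nat.card A := by omega
  have hgx : F.rank (F.gen x) = 0 := (F.rank_apply F.gen_mem x).trans hx
  have hφx : F.rank (φ x) = 0 := (F.rank_automorphism hN hφ x).trans hx
  have hφgx : F.rank (φ (F.gen x)) = 0 := (F.rank_automorphism hN hφ _).trans hgx
  have hne : ∀ z, F.rank z = 0 → F.gen z ≠ z := fun z hz h =>
    F.gen_ne_one hN (F.eq_one_of_apply F.gen_mem hz h)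
  rcases hF with h2 | ⟨-, v, hv1, hv2⟩
  · by_contra hcon
    have hsub : ({φ x, F.gen (φ x), φ (F.gen x)} : Set V) ⊆ {z | F.rank z = 0} := by
      rintro z (rfl | rfl | rfl)
      · exact hφx
      · exact (F.rank_apply F.gen_mem _).trans hφx
      · exact hφgx
    have h3 := Set.ncard_le_ncard hsub
    rw [F.ncard_rank_zero, h2, Set.ncard_eq_three.2 ⟨_, _, _, (hne _ hφx).symm,
      (φ.injective.ne (hne x hx)).symm, Ne.symm hcon, rfl⟩] at h3
    omega
  · obtain ⟨y, hy, hxy⟩ := F.exists_linked_right hx v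
    rw [hv1] at hy
    have hy0 : F.rank y ≠ 0 := by omega
    have hφy : F.rank (φ y) = F.rank v := by rw [F.rank_automorphism hN hφ, hy, hv1]
    have hmove : ∀ z, F.rank z = F.rank v → F.gen (F.gen z) ≠ z := fun z hz h =>
      hv2 (F.apply_eq_self_of_rank_eq (A.mul_mem F.gen_mem F.gen_mem) hz h)
    have hgy : F.gen y ≠ y := fun h => hmove y (hy.trans hv1.symm) (by rw [h, h])
    have hl1 := (F.linked_automorphism hN hφ hy0 hgy hxy).apply F.gen_mem
    have hl2 := F.linked_gen_automorphism hN hφ hy (hxy.apply F.gen_mem)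
    -- Both `gen (φ x)` and `φ (gen x)` lie over `gen (φ y)`, hence differ by some `c` in its
    -- stabilizer.
    obtain ⟨c, hc, hc1, hc2⟩ := hl1.exists_left hl2
    by_cases h1 : c = 1
    · rw [← hc1, h1, Perm.one_apply]
    have h5 := F.five_le_card (y := F.gen (φ y))
      (hmove _ ((F.rank_apply F.gen_mem _).trans hφy)) hc hc2 h1
    have hcol := F.mem_edgeColorAut_labeling.1 hφ x (F.gen x) (hne x hx).symm
    rw [color_of_rank_zero hφx hφgx, color_of_rank_zero hx hgx, innerColor, innerColor,
      if_pos (c := _ ∧ (F.gen x = F.gen x ∨ _)) ⟨h5, Or.inl rfl⟩] at hcol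
    split_ifs at hcol with hadj
    · rcases hadj.2 with h | h
      · exact h
      · exfalso
        -- Reversing the cycle would force `gen² c = 1`, so `gen²` would fix `gen (φ y)`, whose
        -- orbit is too large for that.
        have h6 : (F.gen * F.gen * c) (φ x) = φ x := by
          rw [Perm.mul_apply, Perm.mul_apply, F.apply_comm F.gen_mem hc, hc1, ← h]
        have h7 : (F.gen * F.gen * c) = 1 := F.eq_one_of_apply
          (A.mul_mem (A.mul_mem F.gen_mem F.gen_mem) hc) hφx h6
        refine hmove (F.gen (φ y)) ((F.rank_apply F.gen_mem _).trans hφy) ?_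
        have h8 := congrArg (fun t : Perm V => t (F.gen (φ y))) h7
        simpa [hc2] using h8
    · exact absurd hcol (by decide)

theorem edgeColorAut_labeling [Finite V]
    (hF : Nat.card A = 2 ∨ 2 ≤ Nat.card A ∧ ∃ v, F.rank v = 1 ∧ F.gen (F.gen v) ≠ v) :
    edgeColorAut F.labeling = A := by
  refine le_antisymm (fun φ hφ => ?_) F.le_edgeColorAut
  have hN : 2 ≤ Nat.card A := by omega
  obtain ⟨a, ha, hao⟩ := (F.rank_eq_iff F.origin (φ F.origin)).1
    (F.rank_automorphism hN hφ _).symm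
  have hψ : a⁻¹ * φ ∈ edgeColorAut F.labeling :=
    mul_mem (inv_mem (F.le_edgeColorAut ha)) hφ
  -- After correction by `a`, the automorphism fixes the origin, hence the regular orbit pointwise,
  -- and then each moved point outside through its fibre.
  suffices h : a⁻¹ * φ = 1 by rwa [← inv_mul_eq_one.1 h]
  have hψo : (a⁻¹ * φ) F.origin = F.origin := by
    rw [Perm.mul_apply, ← hao, Perm.inv_def, Equiv.symm_apply_apply]
  generalize a⁻¹ * φ = ψ at hψ hψo
  have hpow : ∀ k : ℕ, ψ ((F.gen ^ k) F.origin) = (F.gen ^ k) F.origin := by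
    intro k
    induction k with
    | zero => exact hψo
    | succ k ih =>
      rw [pow_succ', Perm.mul_apply, F.automorphism_gen hF hψ, ih]
      exact (F.rank_apply (A.pow_mem F.gen_mem k) _).trans F.rank_origin
  have hfix : ∀ x, F.rank x = 0 → ψ x = x := by
    intro x hx
    obtain ⟨b, hb, rfl⟩ := (F.rank_eq_iff F.origin x).1 (F.rank_origin.trans hx.symm)
    rw [← F.zpowers_gen, ← mem_powers_iff_mem_zpowers] at hb
    obtain ⟨k, rfl⟩ := hb
    exact hpow k
  ext y
  rw [Perm.one_apply]
  by_cases hy0 : F.rank y = 0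
  · exact hfix y hy0
  have hr : F.rank (ψ y) = F.rank y := F.rank_automorphism hN hψ y
  by_cases hy : F.gen y = y
  · obtain ⟨b, hb, hby⟩ := (F.rank_eq_iff y (ψ y)).1 hr.symm
    rw [← hby, F.apply_eq_self_of_gen hy hb]
  · obtain ⟨x, hx⟩ := F.exists_linked_left y
    have h := F.linked_automorphism hN hψ hy0 hy hx
    rw [hfix x hx.rank_eq_zero] at h
    exact h.eq_right hx hr

end OrbitFrame

/-! ### Existence of a frame -/

/-- Any numbering of `Q` is corrected by two transpositions of values, moving `p` to 0 and then `q`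
to 1. -/
theorem exists_initial_ranking {Q : Type*} [Finite Q] (p q : Q) :
    ∃ r : Q → ℕ, Function.Injective r ∧ r p = 0 ∧ (q ≠ p → r q = 1) ∧
      ∀ s, ∀ j ≤ r s, ∃ t, r t = j := by
  obtain ⟨n, ⟨e⟩⟩ := Finite.exists_equiv_fin Q
  have step : ∀ (r : Q → ℕ) (s : Q) (i : ℕ), Function.Injective r → Set.range r = Set.Iio n →
      i < n → Function.Injective (Equiv.swap (r s) i ∘ r) ∧
        Set.range (Equiv.swap (r s) i ∘ r) = Set.Iio n := by
    intro r s i hr hrange hi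
    refine ⟨(Equiv.injective _).comp hr, ?_⟩
    rw [Set.range_comp, hrange]
    have hs : r s < n := hrange.le ⟨s, rfl⟩
    ext k
    rw [Equiv.image_eq_preimage_symm, Set.mem_preimage, Equiv.symm_swap, Equiv.swap_apply_def]
    simp only [Set.mem_Iio]
    split_ifs <;> omega
  have hn : 0 < n := (Nat.zero_le _).trans_lt (e p).2
  have h0 : Set.range (fun s => (e s : ℕ)) = Set.Iio n := by
    ext k
    exact ⟨fun ⟨s, hs⟩ => hs ▸ (e s).2, fun hk => ⟨e.symm ⟨k, hk⟩, by simp⟩⟩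
  obtain ⟨i1, r1⟩ := step _ p 0 (Fin.val_injective.comp e.injective) h0 hn
  set f := Equiv.swap (e p : ℕ) 0 ∘ fun s => (e s : ℕ)
  have hfp : f p = 0 := Equiv.swap_apply_left _ _
  have fin : ∀ r : Q → ℕ, Set.range r = Set.Iio n → ∀ s, ∀ j ≤ r s, ∃ t, r t = j :=
    fun r hr s j hj => hr.ge (hj.trans_lt (hr.le ⟨s, rfl⟩))
  by_cases hpq : q = p
  · exact ⟨f, i1, hfp, fun h => absurd hpq h, fin f r1⟩
  have hq : f q ≠ 0 := fun h => hpq (i1 (h.trans hfp.symm))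
  have hqn : f q < n := r1.le ⟨q, rfl⟩
  obtain ⟨i2, r2⟩ := step f q 1 i1 r1 (by omega)
  refine ⟨_, i2, ?_, fun _ => Equiv.swap_apply_left _ _, fin _ r2⟩
  rw [Function.comp_apply, hfp]
  exact Equiv.swap_apply_of_ne_of_ne hq.symm (by omega)

/-- A cyclic permutation group of prime power order has a point with trivial stabilizer. -/
theorem exists_trivial_stabilizer {V : Type*} [Finite V] {A : Subgroup (Perm V)} {g : Perm V}
    (hg : Subgroup.zpowers g = A) (hord : IsPrimePow (Nat.card A)) :
    ∃ v, ∀ a ∈ A, a v = v → a = 1 := by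
  obtain ⟨p, n, hp, hn, hpn⟩ := hord
  rw [← Nat.prime_iff] at hp
  have hog : orderOf g = p ^ n := by rw [← Nat.card_zpowers, hg, hpn]
  obtain ⟨m, rfl⟩ : ∃ m, n = m + 1 := ⟨n - 1, by omega⟩
  have h1 : g ^ p ^ m ≠ 1 := fun h => by
    have := orderOf_dvd_of_pow_eq_one h
    rw [hog, Nat.pow_dvd_pow_iff_le_right hp.one_lt] at this
    omega
  -- A point moved by `g ^ p ^ m` has period dividing `p ^ (m + 1)` but not `p ^ m`, so its period
  -- is the full order.
  obtain ⟨v, hv⟩ := DFunLike.ne_iff.1 h1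
  refine ⟨v, fun a ha hav => ?_⟩
  have hper : MulAction.period g v = p ^ (m + 1) := by
    obtain ⟨i, hi, h⟩ := (Nat.dvd_prime_pow hp).1 (hog ▸ MulAction.period_dvd_orderOf g v)
    rcases hi.lt_or_eq with hlt | rfl
    · refine absurd ?_ hv
      have : MulAction.period g v ∣ p ^ m := h ▸ pow_dvd_pow p (by omega)
      exact MulAction.pow_smul_eq_iff_period_dvd.2 this
    · exact h
  rw [← hg] at ha
  obtain ⟨k, rfl⟩ := ha
  have hk : g ^ k • v = v := hav
  rw [MulAction.zpow_smul_eq_iff_period_dvd, hper, ← hog] at hk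
  exact orderOf_dvd_iff_zpow_eq_one.1 hk

theorem orbitRel_mk_eq_iff {V : Type*} {A : Subgroup (Perm V)} {u v : V} :
    (Quotient.mk'' u : MulAction.orbitRel.Quotient A V) = Quotient.mk'' v ↔ ∃ a ∈ A, a u = v := by
  rw [Quotient.eq'', MulAction.orbitRel_apply]
  constructor
  · rintro ⟨a, h⟩
    exact ⟨a⁻¹, (a⁻¹).2, by rw [← h]; exact inv_smul_smul a v⟩
  · rintro ⟨a, ha, rfl⟩
    exact ⟨⟨a, ha⟩⁻¹, inv_smul_smul (⟨a, ha⟩ : A) u⟩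

theorem exists_orbitFrame {V : Type*} [Finite V] {A : Subgroup (Perm V)} {g : Perm V}
    (hg : Subgroup.zpowers g = A) {v₀ : V} (hv₀ : ∀ a ∈ A, a v₀ = v₀ → a = 1) (v : V) :
    ∃ F : OrbitFrame A, F.gen = g ∧ ((¬ ∃ a ∈ A, a v = v₀) → F.rank v = 1) := by
  obtain ⟨r, hr, h0, h1, h2⟩ := exists_initial_ranking
    (Quotient.mk'' v₀ : MulAction.orbitRel.Quotient A V) (Quotient.mk'' v)
  refine ⟨⟨g, hg, v₀, hv₀, fun u => r (Quotient.mk'' u), fun u w => ?_, h0, fun u j hj => ?_⟩,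
    rfl, fun h => h1 fun h' => h (orbitRel_mk_eq_iff.1 h')⟩
  · rw [hr.eq_iff, orbitRel_mk_eq_iff]
  · obtain ⟨t, ht⟩ := h2 _ j hj
    induction t using Quotient.inductionOn' with | h t => exact ⟨t, ht⟩

/-! ### Orbits of size at most two -/

theorem apply_apply_eq_self_of_ncard_le_two {V : Type*} [Finite V] {A : Subgroup (Perm V)} {v : V}
    (h : (MulAction.orbit A v).ncard ≤ 2) {a : Perm V} (ha : a ∈ A) : a (a v) = v := by
  by_contra hv
  have hv1 : a v ≠ v := fun h => hv (by rw [h, h])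
  have h3 : ({v, a v, a (a v)} : Set V) ⊆ MulAction.orbit A v := by
    rintro z (rfl | rfl | rfl)
    · exact MulAction.mem_orbit_self _
    · exact ⟨⟨a, ha⟩, rfl⟩
    · exact ⟨⟨a * a, A.mul_mem ha ha⟩, rfl⟩
  have h4 := Set.ncard_le_ncard h3
  rw [Set.ncard_eq_three.2 ⟨_, _, _, hv1.symm, Ne.symm hv, (a.injective.ne hv1).symm, rfl⟩] at h4
  omega

theorem ncard_orbit_le_two {V : Type*} [Finite V] {g : Perm V} {v : V} (h : g (g v) = v) :
    (MulAction.orbit (Subgroup.zpowers g) v).ncard ≤ 2 := by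
  refine (Set.ncard_le_ncard (t := {v, g v}) ?_).trans
    ((Set.ncard_insert_le _ _).trans (by simp))
  rintro z ⟨⟨a, ha⟩, rfl⟩
  obtain ⟨k, rfl⟩ := mem_powers_iff_mem_zpowers.2 ha
  change (g ^ k) v ∈ _
  clear ha
  induction k with
  | zero => simp
  | succ k ih =>
    rw [pow_succ', Perm.mul_apply]
    rcases ih with ih | ih
    · rw [ih]; simp
    · rw [ih, h]; simp

/-! ### Sufficiency -/

theorem inGRk_three {V : Type*} [Finite V] {A : Subgroup (Perm V)} {g : Perm V}
    (hg : Subgroup.zpowers g = A) (hord : IsPrimePow (Nat.card A))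
    (h : TwoLargeOrbits A ∨ Nat.card A = 2) : InGRk 3 A := by
  obtain ⟨v₀, hv₀⟩ := exists_trivial_stabilizer hg hord
  rcases h with ⟨ω₁, ω₂, hne, h1, h2⟩ | h
  · obtain ⟨v, hv, hvc⟩ : ∃ v, (¬ ∃ a ∈ A, a v = v₀) ∧ 2 < (MulAction.orbit A v).ncard := by
      by_cases h : ω₁ = Quotient.mk'' v₀
      · induction ω₂ using Quotient.inductionOn' with | h v =>
        exact ⟨v, fun h' => hne (h.trans (orbitRel_mk_eq_iff.2 h').symm), h2⟩
      · induction ω₁ using Quotient.inductionOn' with | h v =>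
        exact ⟨v, fun h' => h (orbitRel_mk_eq_iff.2 h'), h1⟩
    obtain ⟨F, hFg, hF⟩ := exists_orbitFrame hg hv₀ v
    refine ⟨F.labeling, F.edgeColorAut_labeling (Or.inr ⟨hord.two_le, v, hF hv, fun h => ?_⟩)⟩
    rw [hFg] at h
    subst hg
    exact absurd (ncard_orbit_le_two h) (by omega)
  · obtain ⟨F, -⟩ := exists_orbitFrame hg hv₀ v₀
    exact ⟨F.labeling, F.edgeColorAut_labeling (Or.inl h)⟩

/-! ### Necessity -/

open Classical in
/-- The map that inverts the coordinate of the points in the regular orbit of `v` and fixes the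
other points. -/
noncomputable def orbitReflection {V : Type*} (A : Subgroup (Perm V)) (v w : V) : V :=
  if h : ∃ a ∈ A, a v = w then h.choose⁻¹ v else w

theorem orbitReflection_apply {V : Type*} {A : Subgroup (Perm V)} {v : V}
    (hv : ∀ a ∈ A, a v = v → a = 1) {a : Perm V} (ha : a ∈ A) :
    orbitReflection A v (a v) = a⁻¹ v := by
  have h : ∃ b ∈ A, b v = a v := ⟨a, ha, rfl⟩
  obtain ⟨h1, h2⟩ := h.choose_spec
  have : h.choose⁻¹ * a = 1 :=
    hv _ (A.mul_mem (A.inv_mem h1) ha) (by rw [Perm.mul_apply, Perm.inv_def, Equiv.symm_apply_eq, h2])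
  rw [orbitReflection, dif_pos h, inv_mul_eq_one.1 this]

theorem orbitReflection_of_not_mem {V : Type*} {A : Subgroup (Perm V)} {v w : V}
    (h : ¬ ∃ a ∈ A, a v = w) : orbitReflection A v w = w :=
  dif_neg h

theorem orbitReflection_involutive {V : Type*} {A : Subgroup (Perm V)} {v : V}
    (hv : ∀ a ∈ A, a v = v → a = 1) : Function.Involutive (orbitReflection A v) := by
  intro w
  by_cases h : ∃ a ∈ A, a v = w
  · obtain ⟨a, ha, rfl⟩ := h
    rw [orbitReflection_apply hv ha, orbitReflection_apply hv (A.inv_mem ha), inv_inv]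
  · rw [orbitReflection_of_not_mem h, orbitReflection_of_not_mem h]

theorem orbitReflection_mem_edgeColorAut {V K : Type*} [Finite V] {A : Subgroup (Perm V)} {v : V}
    (hcomm : ∀ a ∈ A, ∀ b ∈ A, a * b = b * a)
    (hv : ∀ a ∈ A, a v = v → a = 1) (E : SimpleGraph.TopEdgeLabeling V K)
    (hE : edgeColorAut E = A)
    (hsmall : ∀ w, (¬ ∃ a ∈ A, a v = w) → (MulAction.orbit A w).ncard ≤ 2) :
    (orbitReflection_involutive hv).toPerm ∈ edgeColorAut E := by
  have hA : ∀ a ∈ A, ∀ u w h h', E.get (a u) (a w) h' = E.get u w h := by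
    intro a ha u w h h'
    rw [← hE] at ha
    exact ha u w h
  have get_congr : ∀ {u u' w w' : V} (h h'), u = u' → w = w' → E.get u w h = E.get u' w' h' := by
    rintro u _ w _ h h' rfl rfl
    rfl
  have mixed : ∀ a ∈ A, ∀ w, (¬ ∃ a ∈ A, a v = w) → ∀ h h',
      E.get (a⁻¹ v) w h' = E.get (a v) w h := by
    intro a ha w hw h h'
    -- Translation by `a²` carries `a⁻¹ v` to `a v` and fixes `w`.
    rw [← hA (a * a) (A.mul_mem ha ha) (a⁻¹ v) w h' ((a * a).injective.ne h')]
    refine get_congr _ _ (by simp) ?_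
    exact apply_apply_eq_self_of_ncard_le_two (hsmall w hw) ha
  intro u w h
  by_cases hu : ∃ a ∈ A, a v = u <;> by_cases hw : ∃ a ∈ A, a v = w
  · obtain ⟨a, ha, rfl⟩ := hu
    obtain ⟨b, hb, rfl⟩ := hw
    have hne : a⁻¹ v ≠ b⁻¹ v := by
      rw [← orbitReflection_apply hv ha, ← orbitReflection_apply hv hb]
      exact (orbitReflection_involutive hv).injective.ne h
    refine (get_congr _ hne (orbitReflection_apply hv ha) (orbitReflection_apply hv hb)).trans ?_
    -- Translation by `a b` carries the reflected pair back to the original one with its ends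
    -- exchanged; edges being unordered, the colour agrees.
    rw [← hA (a * b) (A.mul_mem ha hb) _ _ hne ((a * b).injective.ne hne),
      get_congr (u' := b v) (w' := a v) _ h.symm, SimpleGraph.EdgeLabeling.get_comm]
    · rw [hcomm a ha b hb]; simp
    · simp
  · obtain ⟨a, ha, rfl⟩ := hu
    have hne : a⁻¹ v ≠ w := fun h' => hw ⟨a⁻¹, A.inv_mem ha, h'⟩
    exact (get_congr _ hne (orbitReflection_apply hv ha) (orbitReflection_of_not_mem hw)).trans
      (mixed a ha w hw h hne)
  · obtain ⟨a, ha, rfl⟩ := hw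
    have hne : a⁻¹ v ≠ u := fun h' => hu ⟨a⁻¹, A.inv_mem ha, h'⟩
    refine (get_congr _ hne.symm (orbitReflection_of_not_mem hu)
      (orbitReflection_apply hv ha)).trans ?_
    rw [SimpleGraph.EdgeLabeling.get_comm, mixed a ha u hu h.symm hne,
      SimpleGraph.EdgeLabeling.get_comm]
  · exact get_congr _ _ (orbitReflection_of_not_mem hu) (orbitReflection_of_not_mem hw)

theorem twoLargeOrbits_or_card_eq_two {V : Type*} [Finite V] {A : Subgroup (Perm V)} {g : Perm V}
    (hg : Subgroup.zpowers g = A) (hord : IsPrimePow (Nat.card A)) (h : InGR A) :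
    TwoLargeOrbits A ∨ Nat.card A = 2 := by
  obtain ⟨k, E, hE⟩ := h
  obtain ⟨v, hv⟩ := exists_trivial_stabilizer hg hord
  have hgA : g ∈ A := hg ▸ Subgroup.mem_zpowers g
  by_contra! hcon
  obtain ⟨hlarge, h2⟩ := hcon
  have hog : orderOf g = Nat.card A := by rw [← Nat.card_zpowers, hg]
  have hgg : g * g ≠ 1 := by
    intro h
    have := Nat.le_of_dvd two_pos (orderOf_dvd_of_pow_eq_one ((pow_two g).trans h))
    have := hord.two_le
    omega
  have hvlarge : 2 < (MulAction.orbit A v).ncard := by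
    by_contra! hle
    exact hgg (hv _ (A.mul_mem hgA hgA) (apply_apply_eq_self_of_ncard_le_two hle hgA))
  have hcomm : ∀ a ∈ A, ∀ b ∈ A, a * b = b * a := by
    subst hg
    rintro _ ⟨i, rfl⟩ _ ⟨j, rfl⟩
    exact (Commute.refl g).zpow_zpow i j
  have hmem := orbitReflection_mem_edgeColorAut hcomm hv E hE fun w hw => by
    by_contra! hw2
    exact hlarge ⟨Quotient.mk'' v, Quotient.mk'' w, fun h => hw (orbitRel_mk_eq_iff.1 h),
      hvlarge, hw2⟩
  rw [hE] at hmem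
  have hone := hv _ hmem (orbitReflection_apply hv A.one_mem)
  have happ : orbitReflection A v (g v) = g v := congrArg (fun t : Perm V => t (g v)) hone
  rw [orbitReflection_apply hv hgA] at happ
  refine hgg (hv _ (A.mul_mem hgA hgA) ?_)
  rw [Perm.mul_apply, ← happ]
  simp

theorem mainTheorem3 {V : Type*} [Finite V] (A : Subgroup (Equiv.Perm V))
    (hcyc : IsCyclic A) (hord : IsPrimePow (Nat.card A)) :
    (InGR A ↔ TwoLargeOrbits A ∨ Nat.card A = 2) ∧ (InGR A → InGRk 3 A) := by
  obtain ⟨g, hg⟩ := (Subgroup.isCyclic_iff_exists_zpowers_eq_top A).1 hcyc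
  exact ⟨⟨twoLargeOrbits_or_card_eq_two hg hord, fun h => ⟨3, inGRk_three hg hord h⟩⟩,
    fun h => inGRk_three hg hord (twoLargeOrbits_or_card_eq_two hg hord h)⟩
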